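/- For $n\ge 1$ let $\mathbf{Z}_n^2$ be the discrete torus $(\mathbf{Z}/n\mathbf{Z})^2$. A configuration is a function $x:\mathbf{Z}_n^2\to\{0,1\}$, identified with the set of sites $p$ with $x[p]=1$; for $s\in\{0,1\}$ let $h_s$ be the homogeneous configuration with $h_s[p]=s$ for all $p$. Toom's rule $R$ is $R(x)[p]=\mathrm{Maj}\bigl(x[p],\,x[p+(0,1)],\,x[p+(1,0)]\bigr)$, where $\mathrm{Maj}$ is the majority function of three bits, and the rule $R^+$ is $$R^+(x)[p]=\max\bigl(y[p],\,y[p+(0,-1)],\,y[p+(-1,0)]\bigr),\qquad y=R(R(x)).$$ Theorem. There is a constant $c\in\mathbf{N}$ such that for every $n\ge 1$ and every subset $S$ of $\mathbf{Z}_n^2$, $(R^+)^{cn}(S)=h_0$ or $(R^+)^{cn}(S)=h_1$. -/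

import Mathlib

/-- Sites of the discrete torus `Z_n²`. -/
abbrev Site (n : ℕ) : Type := ZMod n × ZMod n

/-- A configuration assigns a state (`false` is 0, `true` is 1) to each site. -/
abbrev Config (n : ℕ) : Type := Site n → Bool

/-- The majority function of three bits. -/
def maj (x y z : Bool) : Bool := (x && y) || (y && z) || (x && z)

/-- Toom's rule `R`: the majority of the site, its northern and its eastern neighbor. -/
def toomR {n : ℕ} (x : Config n) : Config n :=
  fun p => maj (x p) (x (p + (0, 1))) (x (p + (1, 0)))

/-- The rule `R⁺`: apply `R` twice, then take the maximum of the states of the site and of its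
southern and western neighbors. -/
def toomRPlus {n : ℕ} (x : Config n) : Config n :=
  fun p => max (toomR (toomR x) p)
    (max (toomR (toomR x) (p + (0, -1))) (toomR (toomR x) (p + (-1, 0))))

/-- The homogeneous configuration `h_s`. -/
def homog (n : ℕ) (s : Bool) : Config n := fun _ => s

open Classical in
/-- The configuration identified with a set of sites: state 1 exactly on the set. -/
noncomputable def configOfSet {n : ℕ} (S : Set (Site n)) : Config n := fun p => decide (p ∈ S)

/-! Lift configurations to periodic subsets of the plane and study their components in the
triangular lattice. Toom's rule neither breaks nor merges components (`conn_toom`, `closed_toom`),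
and a step of `plus` shrinks an enclosing triangle by one. So a component of size at most `s` dies
within `s + 1` steps unless dilation merges its images with others. A connected set of size more
than `s` survives `s` steps of Toom's rule, so it spreads over a large triangle
(`Conn.exists_box_subset`); on the torus, size more than `4 * n` suffices to fill everything.

It remains to see that survival for O(`s`) steps forces a connected set of size more than `s`
(`hasLarge`), by induction halving `s`. Otherwise, trace a final component back in time. Its lineage
splits into disjoint nonempty parts every `s + 1` steps (`two_pow_mul_le_vol`). After 50 rounds
there are `2 ^ 50` disjoint lineages, each of space-time volume of order `s ^ 3` by the case `s / 2`
(`HasLarge.le_vol`). But the whole lineage lies in triangles growing by 2 per step back, so its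
volume is O(`s ^ 3`) (`vol_le`), with too small a constant. -/

namespace ToomPlane

/-- `p` is one of `b`, its northern neighbor and its eastern neighbor. -/
def Tri (b p : ℤ × ℤ) : Prop := b.1 ≤ p.1 ∧ b.2 ≤ p.2 ∧ p.1 + p.2 ≤ b.1 + b.2 + 1

/-- Equality or adjacency in the triangular lattice. -/
def Near (p q : ℤ × ℤ) : Prop :=
  p.1 - q.1 ≤ 1 ∧ q.1 - p.1 ≤ 1 ∧ p.2 - q.2 ≤ 1 ∧ q.2 - p.2 ≤ 1 ∧
    p.1 + p.2 - q.1 - q.2 ≤ 1 ∧ q.1 + q.2 - p.1 - p.2 ≤ 1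

/-- Toom's rule on subsets of the plane. -/
def toom (x : Set (ℤ × ℤ)) : Set (ℤ × ℤ) :=
  {b | ∃ p q, p ≠ q ∧ Tri b p ∧ Tri b q ∧ p ∈ x ∧ q ∈ x}

/-- Dilation towards north and east. -/
def dilate (x : Set (ℤ × ℤ)) : Set (ℤ × ℤ) := {p | ∃ q ∈ x, Tri q p}

/-- The rule `R⁺` on subsets of the plane. -/
def plus (x : Set (ℤ × ℤ)) : Set (ℤ × ℤ) := dilate (toom (toom x))

/-- `A` is a union of connected components of `x`. -/
def Closed (A x : Set (ℤ × ℤ)) : Prop := A ⊆ x ∧ ∀ p ∈ A, ∀ q ∈ x, Near p q → q ∈ A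

/-- Connectedness in the triangular lattice. -/
def Conn (B : Set (ℤ × ℤ)) : Prop := ∀ A, Closed A B → A.Nonempty → B ⊆ A

/-- The connected component of `q` in `x`. -/
def comp (x : Set (ℤ × ℤ)) (q : ℤ × ℤ) : Set (ℤ × ℤ) := {p | ∀ A, Closed A x → q ∈ A → p ∈ A}

/-- The components of `x` whose image under `plus` meets `C`. -/
def pre (x C : Set (ℤ × ℤ)) : Set (ℤ × ℤ) := {q | q ∈ x ∧ (plus (comp x q) ∩ C).Nonempty}

/-- A triangle with sides facing west, south and northeast. -/
def delta (a b c : ℤ) : Set (ℤ × ℤ) := {p | a ≤ p.1 ∧ b ≤ p.2 ∧ p.1 + p.2 ≤ c}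

/-- `B` is contained in a triangle of size `s`. -/
def Fits (s : ℕ) (B : Set (ℤ × ℤ)) : Prop := ∃ a b, B ⊆ delta a b (a + b + s)

/-! ### Geometry of the triangular lattice -/

lemma Near.symm {p q} (h : Near p q) : Near q p := by
  unfold Near at *; omega

lemma Tri.near {b p q} (h : Tri b p) (h' : Tri b q) : Near p q := by
  unfold Tri Near at *; omega

lemma Tri.near_base {b b' p} (h : Tri b p) (h' : Tri b' p) : Near b b' := by
  unfold Tri Near at *; omega

lemma Tri.near' {b p} (h : Tri b p) : Near b p := by
  unfold Tri Near at *; omega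

lemma tri_self (b) : Tri b b := by unfold Tri; omega

lemma Near.exists_tri {p q} (h : Near p q) : ∃ b, Tri b p ∧ Tri b q :=
  ⟨(min p.1 q.1, min p.2 q.2), by unfold Tri; unfold Near at h; dsimp only; omega,
    by unfold Tri; unfold Near at h; dsimp only; omega⟩

lemma Tri.cases {b p} (h : Tri b p) : p = b ∨ p = (b.1, b.2 + 1) ∨ p = (b.1 + 1, b.2) := by
  obtain ⟨i, j⟩ := p
  obtain ⟨k, l⟩ := b
  simp only [Tri, Prod.mk.injEq] at *
  omega

/-- This finite check is what prevents Toom's rule from merging components. -/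
lemma near_of_two {b b' p q p' q'} (hb : Near b b') (hpq : p ≠ q) (hpq' : p' ≠ q')
    (hp : Tri b p) (hq : Tri b q) (hp' : Tri b' p') (hq' : Tri b' q') :
    Near p p' ∨ Near p q' ∨ Near q p' ∨ Near q q' := by
  obtain ⟨b1, b2⟩ := b
  obtain ⟨c1, c2⟩ := b'
  rcases hp.cases with rfl | rfl | rfl <;> rcases hq.cases with rfl | rfl | rfl <;>
    first
    | exact absurd rfl hpq
    | (rcases hp'.cases with rfl | rfl | rfl <;> rcases hq'.cases with rfl | rfl | rfl <;>
        first
        | exact absurd rfl hpq'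
        | (clear hp hq hp' hq' hpq hpq'
           simp only [Near] at *
           omega))

lemma toom_mono : Monotone toom := fun _ _ h _ ⟨p, q, h0, h1, h2, h3, h4⟩ =>
  ⟨p, q, h0, h1, h2, h h3, h h4⟩

lemma dilate_mono : Monotone dilate := fun _ _ h _ ⟨q, h1, h2⟩ => ⟨q, h h1, h2⟩

lemma plus_mono : Monotone plus := dilate_mono.comp (toom_mono.comp toom_mono)

lemma toom_empty : toom ∅ = ∅ := by ext; simp [toom]

lemma dilate_empty : dilate ∅ = ∅ := by ext; simp [dilate]

lemma plus_empty : plus ∅ = ∅ := by simp [plus, toom_empty, dilate_empty]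

/-! ### Components and their images -/

lemma Closed.diff {A x} (h : Closed A x) : Closed (x \ A) x :=
  ⟨Set.sdiff_subset, fun _ hp _ hq hn => ⟨hq, fun hA => hp.2 (h.2 _ hA _ hp.1 hn.symm)⟩⟩

lemma Closed.trans {A B x} (h : Closed A B) (h' : Closed B x) : Closed A x :=
  ⟨h.1.trans h'.1, fun p hp q hq hn => h.2 p hp q (h'.2 p (h.1 hp) q hq hn) hn⟩

lemma Closed.inter_subset {A x B} (h : Closed A x) (hB : B ⊆ x) : Closed (A ∩ B) B :=
  ⟨Set.inter_subset_right, fun p hp q hq hn => ⟨h.2 p hp.1 q (hB hq) hn, hq⟩⟩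

lemma closed_self (x) : Closed x x := ⟨subset_rfl, fun _ _ _ hq _ => hq⟩

lemma mem_comp_self (x q) : q ∈ comp x q := fun _ _ h => h

lemma comp_subset {x A q} (h : Closed A x) (hq : q ∈ A) : comp x q ⊆ A := fun _ hp => hp A h hq

lemma closed_comp {x q} (hq : q ∈ x) : Closed (comp x q) x :=
  ⟨comp_subset (closed_self x) hq,
    fun p hp r hr hn A hA hqA => hA.2 p (hp A hA hqA) r hr hn⟩

lemma conn_comp {x q} (hq : q ∈ x) : Conn (comp x q) := by
  intro A hA ⟨r, hr⟩
  have hA' := hA.trans (closed_comp hq)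
  by_cases h : q ∈ A
  · exact comp_subset hA' h
  · have := comp_subset (hA.diff.trans (closed_comp hq)) (q := q) ⟨mem_comp_self x q, h⟩
    exact absurd hr (this (hA.1 hr)).2

lemma comp_eq {x q p} (hq : q ∈ x) (hp : p ∈ comp x q) : comp x p = comp x q := by
  have hpx : p ∈ x := (closed_comp hq).1 hp
  have hsub := comp_subset (closed_comp hq) hp
  refine hsub.antisymm (conn_comp hq _ ⟨hsub, fun r hr t ht hn => ?_⟩ ⟨p, mem_comp_self _ _⟩)
  exact (closed_comp hpx).2 r hr t ((closed_comp hq).1 ht) hn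

lemma Conn.subset_of_closed {A x B} (hB : Conn B) (hBx : B ⊆ x) (hA : Closed A x)
    (h : (B ∩ A).Nonempty) : B ⊆ A :=
  (hB _ (hA.inter_subset hBx) (by rwa [Set.inter_comm])).trans Set.inter_subset_left

lemma conn_toom {B} (h : Conn B) : Conn (toom B) := by
  intro A hA ⟨a, ha⟩
  -- The points covered by triangles based in `A` are closed in `B`: near points share a triangle,
  -- whose base is near the old one.
  have key : B ⊆ {p | p ∈ B ∧ ∃ b ∈ A, Tri b p} := by
    refine h _ ⟨fun _ hp => hp.1, ?_⟩ ?_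
    · rintro p ⟨hp, b, hb, hbp⟩ q hq hn
      refine ⟨hq, ?_⟩
      by_cases hpq : p = q
      · exact ⟨b, hb, hpq ▸ hbp⟩
      · obtain ⟨b', h1, h2⟩ := hn.exists_tri
        exact ⟨b', hA.2 b hb b' ⟨p, q, hpq, h1, h2, hp, hq⟩ (hbp.near_base h1), h2⟩
    · obtain ⟨p, q, -, h1, -, h3, -⟩ := hA.1 ha
      exact ⟨p, h3, a, ha, h1⟩
  intro b hb
  obtain ⟨p, q, -, h1, -, h3, -⟩ := id hb
  obtain ⟨-, b', hb', h4⟩ := key h3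
  exact hA.2 b' hb' b hb (h4.near_base h1)

lemma subset_dilate (B) : B ⊆ dilate B := fun p hp => ⟨p, hp, tri_self p⟩

lemma conn_dilate {B} (h : Conn B) : Conn (dilate B) := by
  intro A hA ⟨a, ha⟩
  have key : B ⊆ A := by
    refine h.subset_of_closed (subset_dilate B) hA ?_
    obtain ⟨q, hq, hqa⟩ := hA.1 ha
    exact ⟨q, hq, hA.2 a ha q (subset_dilate B hq) hqa.near'.symm⟩
  rintro p ⟨q, hq, hqp⟩
  exact hA.2 q (key hq) p ⟨q, hq, hqp⟩ hqp.near'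

lemma conn_plus {B} (h : Conn B) : Conn (plus B) :=
  conn_dilate (conn_toom (conn_toom h))

lemma closed_toom {A x} (h : Closed A x) : Closed (toom A) (toom x) := by
  refine ⟨toom_mono h.1, ?_⟩
  rintro b ⟨p, q, hpq, hp, hq, hpA, hqA⟩ b' ⟨p', q', hpq', hp', hq', hpx, hqx⟩ hn
  have hmem : p' ∈ A ∨ q' ∈ A := by
    rcases near_of_two hn hpq hpq' hp hq hp' hq' with h1 | h1 | h1 | h1
    · exact .inl (h.2 _ hpA _ hpx h1)
    · exact .inr (h.2 _ hpA _ hqx h1)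
    · exact .inl (h.2 _ hqA _ hpx h1)
    · exact .inr (h.2 _ hqA _ hqx h1)
  have hnn := hp'.near hq'
  rcases hmem with h1 | h1
  · exact ⟨p', q', hpq', hp', hq', h1, h.2 _ h1 _ hqx hnn⟩
  · exact ⟨p', q', hpq', hp', hq', h.2 _ h1 _ hpx hnn.symm, h1⟩

lemma exists_mem_toom_comp {x b} (hb : b ∈ toom x) : ∃ p ∈ x, b ∈ toom (comp x p) := by
  obtain ⟨p, q, hpq, hp, hq, hpx, hqx⟩ := hb
  exact ⟨p, hpx, p, q, hpq, hp, hq, mem_comp_self x p,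
    (closed_comp hpx).2 _ (mem_comp_self x p) _ hqx (hp.near hq)⟩

lemma exists_mem_plus_comp {x c} (hc : c ∈ plus x) : ∃ p ∈ x, c ∈ plus (comp x p) := by
  obtain ⟨e, ⟨b, b', hbb, hb, hb', hbx, hbx'⟩, hec⟩ := hc
  obtain ⟨p, hp, hbp⟩ := exists_mem_toom_comp hbx
  refine ⟨p, hp, e, ⟨b, b', hbb, hb, hb', hbp, ?_⟩, hec⟩
  exact (closed_toom (closed_comp hp)).2 b hbp b' hbx' (hb.near hb')

section Pre
variable {x C : Set (ℤ × ℤ)}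

lemma plus_comp_subset (hC : Closed C (plus x)) {q} (hq : q ∈ pre x C) : plus (comp x q) ⊆ C :=
  (conn_plus (conn_comp hq.1)).subset_of_closed (plus_mono (closed_comp hq.1).1) hC hq.2

lemma closed_pre (x C) : Closed (pre x C) x := by
  refine ⟨fun _ h => h.1, fun p hp q hq hn => ⟨hq, ?_⟩⟩
  rw [comp_eq hp.1 ((closed_comp hp.1).2 p (mem_comp_self x p) q hq hn)]
  exact hp.2

/-- Dilation may merge images of several components, so all ancestors of `C` are collected; none is
shared with a disjoint `C'` (`disjoint_pre`). -/
lemma plus_pre (hC : Closed C (plus x)) : plus (pre x C) = C := by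
  apply Set.Subset.antisymm
  · intro c hc
    obtain ⟨p, hp, hcp⟩ := exists_mem_plus_comp hc
    refine plus_comp_subset hC hp (plus_mono ?_ hcp)
    intro r hr A hA hpA
    exact (hr _ (hA.inter_subset (closed_pre x C).1) ⟨hpA, hp⟩).1
  · intro c hc
    obtain ⟨p, hp, hcp⟩ := exists_mem_plus_comp (hC.1 hc)
    have hpp : p ∈ pre x C := ⟨hp, c, hcp, hc⟩
    exact plus_mono (comp_subset (closed_pre x C) hpp) hcp

lemma disjoint_pre {C'} (hC' : Closed C' (plus x)) (h : Disjoint C C') :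
    Disjoint (pre x C) (pre x C') := by
  rw [Set.disjoint_left]
  intro q hq hq'
  obtain ⟨c, hc, hcC⟩ := hq.2
  exact Set.disjoint_left.1 h hcC (plus_comp_subset hC' hq' hc)

end Pre

/-! ### Shrinking and spreading of triangles -/

lemma toom_delta {B a b c} (h : B ⊆ delta a b c) : toom B ⊆ delta a b (c - 1) := by
  rintro ⟨u, v⟩ ⟨⟨p1, p2⟩, ⟨q1, q2⟩, hpq, hp, hq, hpB, hqB⟩
  have h1 := h hpB
  have h2 := h hqB
  have h3 : p1 ≠ q1 ∨ p2 ≠ q2 := by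
    by_contra! h4
    exact hpq (by rw [h4.1, h4.2])
  simp only [delta, Tri, Set.mem_ofPred_eq] at *
  omega

lemma dilate_delta {B a b c} (h : B ⊆ delta a b c) : dilate B ⊆ delta a b (c + 1) := by
  rintro p ⟨q, hq, hqp⟩
  have h1 := h hq
  simp only [delta, Tri, Set.mem_ofPred_eq] at *
  omega

lemma plus_delta {B a b c} (h : B ⊆ delta a b c) : plus B ⊆ delta a b (c - 1) := by
  have := dilate_delta (toom_delta (toom_delta h))
  rwa [sub_add_cancel] at this

lemma iterate_plus_delta {B a b c} (h : B ⊆ delta a b c) (k : ℕ) :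
    plus^[k] B ⊆ delta a b (c - k) := by
  induction k with
  | zero => simpa using h
  | succ k ih =>
    rw [Function.iterate_succ_apply']
    convert plus_delta ih using 2
    push_cast; ring

lemma delta_eq_empty {a b c : ℤ} (h : c < a + b) : delta a b c = ∅ := by
  ext p; simp only [delta, Set.mem_ofPred_eq, Set.mem_empty_iff_false, iff_false]; omega

lemma Fits.iterate_plus {s B} (h : Fits s B) {k : ℕ} (hk : s < k) : plus^[k] B = ∅ := by
  obtain ⟨a, b, hB⟩ := h
  have := iterate_plus_delta hB k
  rw [delta_eq_empty (by omega)] at this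
  exact Set.subset_empty_iff.1 this

/-- A connected set with nonempty image is covered by the triangles based at its image. -/
lemma Conn.exists_tri {B} (hB : Conn B) (h : (toom B).Nonempty) {p} (hp : p ∈ B) :
    ∃ b ∈ toom B, Tri b p := by
  by_contra! hno
  have h1 : Closed {p} B := by
    refine ⟨by simpa using hp, ?_⟩
    rintro _ rfl q hq hn
    by_contra hqp
    obtain ⟨b, h1, h2⟩ := hn.exists_tri
    exact hno b ⟨_, q, Ne.symm hqp, h1, h2, hp, hq⟩ h1
  have h2 := hB _ h1 ⟨p, rfl⟩
  obtain ⟨b, q, r, hqr, -, -, hq, hr⟩ := h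
  exact hqr ((h2 hq).trans (h2 hr).symm)

lemma Conn.subset_delta_of_toom {B a b c} (hB : Conn B) (h : (toom B).Nonempty)
    (hs : toom B ⊆ delta a b c) : B ⊆ delta a b (c + 1) := by
  intro p hp
  obtain ⟨q, hq, hqp⟩ := hB.exists_tri h hp
  have h1 := hs hq
  simp only [delta, Tri, Set.mem_ofPred_eq] at *
  omega

/-- Undoing the dilation costs nothing; undoing each Toom step moves only the northeast side, by
one. -/
lemma pre_subset_delta {x C a b c} (hC : Closed C (plus x)) (h : C ⊆ delta a b c) :
    pre x C ⊆ delta a b (c + 2) := by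
  intro q hq
  have hK := conn_comp hq.1
  have hne : (toom (toom (comp x q))).Nonempty := by
    obtain ⟨c, ⟨e, he, -⟩, -⟩ := hq.2
    exact ⟨e, he⟩
  have hne' : (toom (comp x q)).Nonempty := by
    obtain ⟨_, p, _, _, _, _, hp, _⟩ := hne
    exact ⟨p, hp⟩
  have h1 := (conn_toom hK).subset_delta_of_toom hne
    (((subset_dilate _).trans (plus_comp_subset hC hq)).trans h)
  have h2 := hK.subset_delta_of_toom hne' h1 (mem_comp_self x q)
  convert h2 using 2
  ring

lemma Conn.not_fits_toom {B s} (hB : Conn B) (h : ¬ Fits (s + 1) B) : ¬ Fits s (toom B) := by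
  rintro ⟨a, b, hs⟩
  by_cases hne : (toom B).Nonempty
  · refine h ⟨a, b, ?_⟩
    convert hB.subset_delta_of_toom hne hs using 2
    push_cast; ring
  -- With an empty image, `B` is a single point, since two near points share a triangle.
  · apply h
    have hBne : B.Nonempty := by
      by_contra h0
      rw [Set.not_nonempty_iff_eq_empty] at h0
      exact h ⟨0, 0, by simp [h0]⟩
    obtain ⟨p, hp⟩ := hBne
    have h1 : Closed {p} B := by
      refine ⟨by simpa using hp, ?_⟩
      rintro _ rfl q hq hn
      by_contra hqp
      obtain ⟨b, h1, h2⟩ := hn.exists_tri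
      exact hne ⟨b, _, q, Ne.symm hqp, h1, h2, hp, hq⟩
    refine ⟨p.1, p.2, (hB _ h1 ⟨p, rfl⟩).trans ?_⟩
    rintro _ rfl
    simp only [delta, Set.mem_ofPred_eq]
    omega

lemma Conn.iterate_toom_nonempty {s B} (hB : Conn B) (h : ¬ Fits s B) {k : ℕ} (hk : k ≤ s) :
    (toom^[k] B).Nonempty := by
  induction k generalizing s B with
  | zero =>
    by_contra h0
    rw [Set.not_nonempty_iff_eq_empty, Function.iterate_zero_apply] at h0
    exact h ⟨0, 0, by simp [h0]⟩
  | succ k ih =>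
    obtain ⟨s, rfl⟩ : ∃ t, s = t + 1 := ⟨s - 1, by omega⟩
    rw [Function.iterate_succ_apply]
    exact ih (conn_toom hB) (hB.not_fits_toom h) (by omega)

/-- Toom's rule commutes with translations: shift both witnesses by `c - b`. -/
lemma dilate_toom_subset (x) : dilate (toom x) ⊆ toom (dilate x) := by
  rintro c ⟨b, ⟨p, q, hpq, hp, hq, hpx, hqx⟩, hbc⟩
  refine ⟨p + (c - b), q + (c - b), fun h => hpq (by simpa using h), ?_, ?_,
    ⟨p, hpx, ?_⟩, ⟨q, hqx, ?_⟩⟩ <;>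
  · simp only [Tri, Prod.fst_add, Prod.snd_add, Prod.fst_sub, Prod.snd_sub] at *
    omega

lemma dilate_iterate_toom_subset (k : ℕ) (x) : dilate (toom^[k] x) ⊆ toom^[k] (dilate x) := by
  induction k generalizing x with
  | zero => exact subset_rfl
  | succ k ih =>
    rw [Function.iterate_succ_apply, Function.iterate_succ_apply]
    exact (ih _).trans (toom_mono.iterate k (dilate_toom_subset x))

lemma iterate_dilate_toom_subset (m : ℕ) (x) : dilate^[m] (toom^[2 * m] x) ⊆ plus^[m] x := by
  induction m generalizing x with
  | zero => exact subset_rfl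
  | succ m ih =>
    have h1 : toom^[2 * (m + 1)] x = toom^[2 * m] (toom (toom x)) := by
      rw [show 2 * (m + 1) = 2 * m + 2 by ring, Function.iterate_add_apply]; rfl
    rw [Function.iterate_succ_apply, Function.iterate_succ_apply, h1]
    exact (dilate_mono.iterate m (dilate_iterate_toom_subset _ _)).trans (ih _)

lemma mem_iterate_dilate {x q} (hq : q ∈ x) {m i j : ℕ} (h : i + j ≤ m) :
    (q.1 + i, q.2 + j) ∈ dilate^[m] x := by
  induction m generalizing i j with
  | zero =>
    obtain ⟨rfl, rfl⟩ : i = 0 ∧ j = 0 := by omega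
    simpa using hq
  | succ m ih =>
    rw [Function.iterate_succ_apply']
    rcases i with _ | i
    · rcases j with _ | j
      · exact ⟨_, ih (i := 0) (j := 0) (by omega), tri_self _⟩
      · refine ⟨_, ih (i := 0) (j := j) (by omega), ?_⟩
        simp only [Tri]; push_cast; omega
    · refine ⟨_, ih (i := i) (j := j) (by omega), ?_⟩
      simp only [Tri]; push_cast; omega

lemma Conn.exists_box_subset {s B m} (hB : Conn B) (h : ¬ Fits s B) (hm : 2 * m ≤ s) :
    ∃ q : ℤ × ℤ, ∀ i j : ℕ, i + j ≤ m → (q.1 + i, q.2 + j) ∈ plus^[m] B := by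
  obtain ⟨q, hq⟩ := hB.iterate_toom_nonempty h hm
  exact ⟨q, fun i j hij => iterate_dilate_toom_subset m B (mem_iterate_dilate hq hij)⟩


/-! ### Histories, lineages and volume -/

/-- `X` lists, backwards in time, the last `M + 1` configurations of an evolution. -/
def IsHist (X : ℕ → Set (ℤ × ℤ)) (M : ℕ) : Prop := ∀ k < M, plus (X (k + 1)) = X k

/-- The backward history of a union of components `C` of `X 0`. -/
def lineage (X : ℕ → Set (ℤ × ℤ)) (C : Set (ℤ × ℤ)) : ℕ → Set (ℤ × ℤ)
  | 0 => C
  | k + 1 => pre (X (k + 1)) (lineage X C k)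

/-- The space-time volume of a history. -/
noncomputable def vol (X : ℕ → Set (ℤ × ℤ)) (M : ℕ) : ℕ∞ := ∑ k ∈ Finset.range (M + 1), (X k).encard

section Hist
variable {X : ℕ → Set (ℤ × ℤ)} {M : ℕ} {C C' : Set (ℤ × ℤ)}

lemma IsHist.mono {N} (h : IsHist X M) (hN : N ≤ M) : IsHist X N :=
  fun k hk => h k (hk.trans_le hN)

lemma IsHist.shift {t} (h : IsHist X (t + M)) : IsHist (fun k => X (t + k)) M :=
  fun k hk => h (t + k) (by omega)

lemma IsHist.iterate {k m} (h : IsHist X M) (hkm : k + m ≤ M) : plus^[m] (X (k + m)) = X k := by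
  induction m with
  | zero => rfl
  | succ m ih =>
    rw [Function.iterate_succ_apply, ← add_assoc, h (k + m) (by omega)]
    exact ih (by omega)

lemma IsHist.nonempty {k} (h : IsHist X M) (h0 : (X 0).Nonempty) (hk : k ≤ M) :
    (X k).Nonempty := by
  induction k with
  | zero => exact h0
  | succ k ih =>
    by_contra h1
    rw [Set.not_nonempty_iff_eq_empty] at h1
    have h2 := ih (by omega)
    rw [← h k (by omega), h1, plus_empty] at h2
    exact h2.ne_empty rfl

lemma closed_lineage (hC : Closed C (X 0)) (k : ℕ) :
    Closed (lineage X C k) (X k) := by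
  cases k with
  | zero => exact hC
  | succ k => exact closed_pre _ _

lemma isHist_lineage (h : IsHist X M) (hC : Closed C (X 0)) : IsHist (lineage X C) M := by
  intro k hk
  refine plus_pre ?_
  rw [h k hk]
  exact closed_lineage hC k

lemma disjoint_lineage (h : IsHist X M) (hC' : Closed C' (X 0))
    (hd : Disjoint C C') {k} (hk : k ≤ M) : Disjoint (lineage X C k) (lineage X C' k) := by
  induction k with
  | zero => exact hd
  | succ k ih =>
    refine disjoint_pre ?_ (ih (by omega))
    rw [h k (by omega)]
    exact closed_lineage hC' k

lemma lineage_subset_delta (h : IsHist X M) (hC : Closed C (X 0)) {a b c : ℤ}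
    (hs : C ⊆ delta a b c) {k : ℕ} (hk : k ≤ M) : lineage X C k ⊆ delta a b (c + 2 * k) := by
  induction k with
  | zero => simpa [lineage] using hs
  | succ k ih =>
    have h1 : Closed (lineage X C k) (plus (X (k + 1))) := by
      rw [h k (by omega)]
      exact closed_lineage hC k
    have h2 := pre_subset_delta h1 (ih (by omega))
    rwa [show c + 2 * (k : ℤ) + 2 = c + 2 * ((k + 1 : ℕ) : ℤ) by push_cast; ring] at h2

lemma vol_shift_le (t : ℕ) : vol (fun k => X (t + k)) M ≤ vol X (t + M) := by
  unfold vol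
  have h := Finset.sum_Ico_eq_sum_range (fun k => (X k).encard) t (t + (M + 1))
  rw [Nat.add_sub_cancel_left] at h
  rw [← h]
  exact Finset.sum_le_sum_of_subset fun k hk => by
    simp only [Finset.mem_Ico, Finset.mem_range] at *; omega

lemma vol_add_le {Y Y' : ℕ → Set (ℤ × ℤ)} (hY : ∀ k ≤ M, Y k ⊆ X k) (hY' : ∀ k ≤ M, Y' k ⊆ X k)
    (hd : ∀ k ≤ M, Disjoint (Y k) (Y' k)) : vol Y M + vol Y' M ≤ vol X M := by
  unfold vol
  rw [← Finset.sum_add_distrib]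
  refine Finset.sum_le_sum fun k hk => ?_
  have hk : k ≤ M := by simpa [Nat.lt_succ_iff] using hk
  rw [← Set.encard_union_eq (hd k hk)]
  exact Set.encard_le_encard (Set.union_subset (hY k hk) (hY' k hk))

lemma delta_encard_le (a b : ℤ) (m : ℕ) : (delta a b (a + b + m)).encard ≤ ((m + 1) ^ 2 : ℕ) := by
  have : delta a b (a + b + m) ⊆
      ((Finset.Icc a (a + m) ×ˢ Finset.Icc b (b + m) : Finset (ℤ × ℤ)) : Set (ℤ × ℤ)) := by
    intro p hp
    simp only [delta, Set.mem_ofPred_eq, Finset.coe_product, Finset.coe_Icc, Set.mem_prod,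
      Set.mem_Icc] at *
    omega
  refine (Set.encard_le_encard this).trans ?_
  rw [Set.encard_coe_eq_coe_finsetCard, Finset.card_product, Int.card_Icc, Int.card_Icc,
    show (a + m + 1 - a).toNat = m + 1 by omega, show (b + m + 1 - b).toNat = m + 1 by omega, sq]

lemma vol_le {a b : ℤ} {s : ℕ} (h : ∀ k ≤ M, X k ⊆ delta a b (a + b + s + 2 * k)) :
    vol X M ≤ ((M + 1) * (s + 2 * M + 1) ^ 2 : ℕ) := by
  unfold vol
  refine (Finset.sum_le_card_nsmul _ _ (((s + 2 * M + 1) ^ 2 : ℕ) : ℕ∞) fun k hk => ?_).trans ?_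
  · have hk : k ≤ M := by simpa [Nat.lt_succ_iff] using hk
    refine (Set.encard_le_encard ((h k hk).trans ?_)).trans (delta_encard_le a b (s + 2 * M))
    intro p hp
    simp only [delta, Set.mem_ofPred_eq] at *
    push_cast
    omega
  · rw [Finset.card_range, nsmul_eq_mul]
    push_cast
    exact le_rfl

lemma box_encard_le {B : Set (ℤ × ℤ)} {q : ℤ × ℤ} {m r : ℕ} (hr : 2 * r ≤ m)
    (h : ∀ i j : ℕ, i + j ≤ m → (q.1 + i, q.2 + j) ∈ B) : (((r + 1) ^ 2 : ℕ) : ℕ∞) ≤ B.encard := by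
  have : ((Finset.Icc q.1 (q.1 + r) ×ˢ Finset.Icc q.2 (q.2 + r) : Finset (ℤ × ℤ)) : Set (ℤ × ℤ))
      ⊆ B := by
    rintro ⟨u, v⟩ hp
    simp only [Finset.coe_product, Finset.coe_Icc, Set.mem_prod, Set.mem_Icc] at hp
    have := h (u - q.1).toNat (v - q.2).toNat (by omega)
    rwa [show q.1 + ((u - q.1).toNat : ℤ) = u by omega,
      show q.2 + ((v - q.2).toNat : ℤ) = v by omega] at this
  refine le_trans ?_ (Set.encard_le_encard this)
  rw [Set.encard_coe_eq_coe_finsetCard, Finset.card_product, Int.card_Icc, Int.card_Icc,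
    show (q.1 + r + 1 - q.1).toNat = r + 1 by omega,
    show (q.2 + r + 1 - q.2).toNat = r + 1 by omega, sq]

end Hist

/-! ### Induction on the scale -/

/-- Every history of length `201 * s + 1` contains a connected set of size more than `s`. -/
def HasLarge (s : ℕ) : Prop :=
  ∀ X, IsHist X (201 * s + 1) → (X 0).Nonempty →
    ∃ k ≤ 201 * s + 1, ∃ B ⊆ X k, Conn B ∧ ¬ Fits s B

lemma HasLarge.le_vol {s r : ℕ} (hs : HasLarge s) (hr : 6 * r ≤ s) {X}
    (hX : IsHist X (3 * r + (201 * s + 1))) (h0 : (X 0).Nonempty) :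
    (((r + 1) ^ 3 : ℕ) : ℕ∞) ≤ vol X (3 * r + (201 * s + 1)) := by
  obtain ⟨k, hk, B, hBX, hB, hfit⟩ := hs _ hX.shift (hX.nonempty h0 (k := 3 * r + 0) (by omega))
  have key : ∀ i ∈ Finset.range (r + 1), (((r + 1) ^ 2 : ℕ) : ℕ∞) ≤ (X (k + i)).encard := by
    intro i hi
    have hi : i ≤ r := by simpa [Nat.lt_succ_iff] using hi
    -- For `i ≤ r`, the time `3 * r - i` is at least `2 * r`, enough for a square of side `r + 1`,
    -- and its double is at most `6 * r ≤ s`.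
    obtain ⟨q, hq⟩ := hB.exists_box_subset hfit (m := 3 * r - i) (by omega)
    refine (box_encard_le (by omega) hq).trans (Set.encard_le_encard ?_)
    rw [← hX.iterate (k := k + i) (m := 3 * r - i) (by omega),
      show k + i + (3 * r - i) = 3 * r + k by omega]
    exact plus_mono.iterate _ hBX
  calc (((r + 1) ^ 3 : ℕ) : ℕ∞)
      = ∑ _i ∈ Finset.range (r + 1), (((r + 1) ^ 2 : ℕ) : ℕ∞) := by
        rw [Finset.sum_const, Finset.card_range, nsmul_eq_mul]; push_cast; ring
    _ ≤ ∑ i ∈ Finset.range (r + 1), (X (k + i)).encard := Finset.sum_le_sum key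
    _ = vol (fun i => X (k + i)) r := rfl
    _ ≤ vol X (k + r) := vol_shift_le k
    _ ≤ _ := Finset.sum_le_sum_of_subset (Finset.range_mono (by omega))

/-- If all components stay of size at most `s`, then lineages split every `s + 1` steps. -/
lemma two_pow_mul_le_vol {s M : ℕ} {v : ℕ∞}
    (hv : ∀ Y, IsHist Y M → (Y 0).Nonempty → v ≤ vol Y M) (j : ℕ) {X}
    (hX : IsHist X (j * (s + 1) + M)) (h0 : (X 0).Nonempty)
    (hfit : ∀ k ≤ j * (s + 1) + M, ∀ B ⊆ X k, Conn B → Fits s B) :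
    2 ^ j * v ≤ vol X (j * (s + 1) + M) := by
  induction j generalizing X with
  | zero =>
    simp only [zero_mul, zero_add, pow_zero, one_mul] at *
    exact hv X hX h0
  | succ j ih =>
    have hM : (j + 1) * (s + 1) + M = (s + 1) + (j * (s + 1) + M) := by ring
    rw [hM] at hX hfit ⊢
    obtain ⟨q, hq⟩ := hX.nonempty h0 (k := s + 1) (by omega)
    have hK := closed_comp hq
    have hne : (X (s + 1) \ comp (X (s + 1)) q).Nonempty := by
      -- A single component would fit in size `s` and die in `s + 1` steps.
      by_contra hem
      rw [Set.not_nonempty_iff_eq_empty, Set.sdiff_eq_empty] at hem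
      have h1 := hfit (s + 1) (by omega) _ hK.1 (conn_comp hq)
      rw [hK.1.antisymm hem] at h1
      have h2 := hX.iterate (k := 0) (m := s + 1) (by omega)
      rw [zero_add, h1.iterate_plus (by omega)] at h2
      exact h0.ne_empty h2.symm
    set Z : ℕ → Set (ℤ × ℤ) := fun k => X (s + 1 + k) with hZ
    have hZh : IsHist Z (j * (s + 1) + M) := hX.shift
    have hlin : ∀ C, Closed C (Z 0) → C.Nonempty →
        2 ^ j * v ≤ vol (lineage Z C) (j * (s + 1) + M) := fun C hC hCne =>
      ih (isHist_lineage hZh hC) hCne fun k hk B hB =>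
        hfit (s + 1 + k) (by omega) B (hB.trans (closed_lineage hC k).1)
    calc 2 ^ (j + 1) * v = 2 ^ j * v + 2 ^ j * v := by ring
      _ ≤ vol (lineage Z (comp (X (s + 1)) q)) (j * (s + 1) + M) +
          vol (lineage Z (X (s + 1) \ comp (X (s + 1)) q)) (j * (s + 1) + M) :=
        add_le_add (hlin _ hK ⟨q, mem_comp_self _ _⟩) (hlin _ hK.diff hne)
      _ ≤ vol Z (j * (s + 1) + M) :=
        vol_add_le (fun k _ => (closed_lineage hK k).1)
          (fun k _ => (closed_lineage hK.diff k).1)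
          (fun k hk => disjoint_lineage hZh hK.diff Set.disjoint_sdiff_right hk)
      _ ≤ _ := vol_shift_le _

lemma hasLarge_zero : HasLarge 0 := by
  intro X hX h0
  obtain ⟨p, hp⟩ := h0
  rw [← hX 0 (by omega)] at hp
  obtain ⟨q, hq, hpq⟩ := exists_mem_plus_comp hp
  refine ⟨1, by omega, _, (closed_comp hq).1, conn_comp hq, fun hf => ?_⟩
  have := hf.iterate_plus (k := 1) (by omega)
  rw [Function.iterate_one] at this
  rw [this] at hpq
  exact hpq

lemma hasLarge_of_half {s : ℕ} (hs : 1 ≤ s) (h : HasLarge (s / 2)) : HasLarge s := by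
  intro X hX ⟨p, hp⟩
  by_contra! hcon
  obtain ⟨a, b, hab⟩ := hcon 0 (by omega) _ (closed_comp hp).1 (conn_comp hp)
  set r := s / 16 with hr
  -- Time for 50 splittings, then for `HasLarge.le_vol` at scale `s / 2`. Here `50 * (s + 1) ≤ 100 *
  -- s`, and the rest is at most `101 * s + 1`.
  set M := 50 * (s + 1) + (3 * r + (201 * (s / 2) + 1)) with hM
  have hML : M ≤ 201 * s + 1 := by omega
  have hX' := hX.mono hML
  have hC := closed_comp hp
  have h1 : 2 ^ 50 * (((r + 1) ^ 3 : ℕ) : ℕ∞) ≤ vol (lineage X (comp (X 0) p)) M :=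
    two_pow_mul_le_vol (s := s) (fun Y hY hY0 => h.le_vol (by omega) hY hY0) 50
      (isHist_lineage hX' hC) ⟨p, mem_comp_self _ _⟩
      (fun k hk B hB => hcon k (hk.trans hML) B (hB.trans (closed_lineage hC k).1))
  have h2 := h1.trans (vol_le (s := s) fun k hk => lineage_subset_delta hX' hC hab hk)
  have h3 : 2 ^ 50 * (r + 1) ^ 3 ≤ (M + 1) * (s + 2 * M + 1) ^ 2 := by exact_mod_cast h2
  -- From `s < 16 * (r + 1)`, with `M + 1 ≤ 203 * s` and `s + 2 * M + 1 ≤ 406 * s`. The resulting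
  -- constant is below `2 ^ 50`.
  have h4 : (M + 1) * (s + 2 * M + 1) ^ 2 ≤ (3248 * (r + 1)) * (6496 * (r + 1)) ^ 2 := by
    gcongr <;> omega
  have h5 : 0 < (r + 1) ^ 3 := by positivity
  have h6 : (3248 * (r + 1)) * (6496 * (r + 1)) ^ 2 = 3248 * 6496 ^ 2 * (r + 1) ^ 3 := by
    ring
  norm_num at h3 h6
  omega

lemma hasLarge (s : ℕ) : HasLarge s := by
  induction s using Nat.strong_induction_on with
  | _ s ih =>
    rcases Nat.eq_zero_or_pos s with rfl | hs
    · exact hasLarge_zero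
    · exact hasLarge_of_half hs (ih _ (by omega))


/-! ### Transfer to the torus -/

lemma mem_toom_iff {x : Set (ℤ × ℤ)} {i j : ℤ} : (i, j) ∈ toom x ↔
    ((i, j) ∈ x ∧ (i, j + 1) ∈ x) ∨ ((i, j + 1) ∈ x ∧ (i + 1, j) ∈ x) ∨
      ((i, j) ∈ x ∧ (i + 1, j) ∈ x) := by
  constructor
  · rintro ⟨p, q, hpq, hp, hq, hpx, hqx⟩
    rcases hp.cases with rfl | rfl | rfl <;> rcases hq.cases with rfl | rfl | rfl <;>
      first
      | exact absurd rfl hpq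
      | tauto
  · rintro (⟨h, h'⟩ | ⟨h, h'⟩ | ⟨h, h'⟩) <;>
      exact ⟨_, _, by simp, by simp only [Tri]; omega, by simp only [Tri]; omega, h, h'⟩

lemma mem_dilate_iff {x : Set (ℤ × ℤ)} {i j : ℤ} : (i, j) ∈ dilate x ↔
    (i, j) ∈ x ∨ (i, j - 1) ∈ x ∨ (i - 1, j) ∈ x := by
  constructor
  · rintro ⟨⟨k, l⟩, hq, h⟩
    have h' : (k = i ∧ l = j) ∨ (k = i ∧ l = j - 1) ∨ (k = i - 1 ∧ l = j) := by
      simp only [Tri] at h; omega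
    rcases h' with ⟨rfl, rfl⟩ | ⟨rfl, rfl⟩ | ⟨rfl, rfl⟩ <;> tauto
  · rintro (h | h | h) <;> exact ⟨_, h, by simp only [Tri]; omega⟩

/-- The periodic subset of the plane described by a configuration on the torus. -/
def lift {n : ℕ} (x : Config n) : Set (ℤ × ℤ) := {p | x ((p.1 : ZMod n), (p.2 : ZMod n)) = true}

lemma mem_lift {n : ℕ} {x : Config n} {i j : ℤ} :
    (i, j) ∈ lift x ↔ x ((i : ZMod n), (j : ZMod n)) = true := Iff.rfl

lemma lift_toomR {n : ℕ} (x : Config n) : lift (toomR x) = toom (lift x) := by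
  ext ⟨i, j⟩
  simp only [mem_toom_iff, mem_lift, toomR, maj, Prod.mk_add_mk, add_zero, Int.cast_add,
    Int.cast_one, Bool.or_eq_true, Bool.and_eq_true, or_assoc]

lemma lift_toomRPlus {n : ℕ} (x : Config n) : lift (toomRPlus x) = plus (lift x) := by
  rw [plus, ← lift_toomR, ← lift_toomR]
  ext ⟨i, j⟩
  simp only [mem_dilate_iff, mem_lift, toomRPlus, Prod.mk_add_mk, add_zero, Int.cast_add,
    Int.cast_neg, Int.cast_one, Bool.max_eq_or, Bool.or_eq_true, sub_eq_add_neg]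

lemma lift_iterate {n : ℕ} (x : Config n) (k : ℕ) : lift (toomRPlus^[k] x) = plus^[k] (lift x) := by
  induction k with
  | zero => rfl
  | succ k ih => rw [Function.iterate_succ_apply', Function.iterate_succ_apply', lift_toomRPlus, ih]

lemma exists_mem_lift {n : ℕ} (p : Site n) :
    ∃ i j : ℤ, ((i : ZMod n), (j : ZMod n)) = p := by
  obtain ⟨i, hi⟩ := ZMod.intCast_surjective p.1
  obtain ⟨j, hj⟩ := ZMod.intCast_surjective p.2
  exact ⟨i, j, Prod.ext hi hj⟩

lemma eq_homog_false {n : ℕ} {x : Config n} (h : lift x = ∅) : x = homog n false := by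
  funext p
  obtain ⟨i, j, rfl⟩ := exists_mem_lift p
  have : (i, j) ∉ lift x := by simp [h]
  simpa [mem_lift, homog] using this

lemma iterate_homog_true {n : ℕ} (k : ℕ) : toomRPlus^[k] (homog n true) = homog n true :=
  Function.iterate_fixed (by funext p; simp [toomRPlus, toomR, homog, maj]) k

lemma iterate_homog_false {n : ℕ} (k : ℕ) : toomRPlus^[k] (homog n false) = homog n false :=
  Function.iterate_fixed (by funext p; simp [toomRPlus, toomR, homog, maj]) k

/-- A single site surviving `4 * n` steps of Toom's rule spreads over the whole torus. -/
lemma iterate_eq_homog_true {n : ℕ} (hn : 1 ≤ n) {x : Config n}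
    (h : (toom^[2 * (2 * n)] (lift x)).Nonempty) : toomRPlus^[2 * n] x = homog n true := by
  obtain ⟨q, hq⟩ := h
  have : NeZero n := ⟨by omega⟩
  funext p
  have h1 := mem_iterate_dilate hq (m := 2 * n) (i := (p.1 - (q.1 : ZMod n)).val)
    (j := (p.2 - (q.2 : ZMod n)).val)
    (by
      have h1 := ZMod.val_lt (p.1 - (q.1 : ZMod n))
      have h2 := ZMod.val_lt (p.2 - (q.2 : ZMod n))
      omega)
  have h2 := iterate_dilate_toom_subset _ _ h1
  rw [← lift_iterate, mem_lift] at h2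
  simpa [homog] using h2

end ToomPlane

open ToomPlane in
theorem theorem1 :
    ∃ c : ℕ, ∀ n : ℕ, 1 ≤ n → ∀ S : Set (Site n),
      toomRPlus^[c * n] (configOfSet S) = homog n false ∨
      toomRPlus^[c * n] (configOfSet S) = homog n true := by
  -- `hasLarge` at scale `4 * n` needs `804 * n + 1 ≤ 805 * n` steps, and filling the torus takes `2
  -- * n` more.
  refine ⟨807, fun n hn S => ?_⟩
  set x : Config n := configOfSet S
  have hsplit : ∀ t ≤ 805 * n,
      toomRPlus^[807 * n] x = toomRPlus^[805 * n - t] (toomRPlus^[2 * n] (toomRPlus^[t] x)) := by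
    intro t ht
    rw [← Function.iterate_add_apply, ← Function.iterate_add_apply]
    congr 1
    omega
  by_cases h0 : (lift (toomRPlus^[805 * n] x)).Nonempty
  · right
    have hX : IsHist (fun k => lift (toomRPlus^[805 * n - k] x)) (201 * (4 * n) + 1) := by
      intro k hk
      simp only
      rw [← lift_toomRPlus, ← Function.iterate_succ_apply' toomRPlus]
      congr 2
      omega
    obtain ⟨k, hk, B, hBX, hB, hfit⟩ := hasLarge (4 * n) _ hX h0
    have hne := (hB.iterate_toom_nonempty hfit (k := 2 * (2 * n)) (by omega)).mono
      (toom_mono.iterate _ hBX)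
    rw [hsplit (805 * n - k) (by omega), iterate_eq_homog_true hn hne, iterate_homog_true]
  · left
    rw [Set.not_nonempty_iff_eq_empty] at h0
    rw [hsplit _ le_rfl, eq_homog_false h0, iterate_homog_false, iterate_homog_false]
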